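/- Variables $x_1,x_2,\dots$ are Boolean, and a literal is a variable $x_i$ or its negation $\overline{x_i}$. For an integer $k\ge 1$, a $k$-SAT clause is a set of $k$ literals on $k$ distinct variables, and a $k$-SAT formula is a finite set of $k$-SAT clauses. A formula is simple if no two distinct clauses of it use exactly the same set of variables. For a formula $B$, let $|B|$ be its number of clauses and let $v(B)$ be the number of variables that appear in some clause of $B$. A subformula of a formula $G$ is a subset of its set of clauses. Two formulae are isomorphic if one is obtained from the other by an injective relabeling of its variables, keeping the signs of all literals. A copy of $B$ in $G$ is a subformula of $G$ isomorphic to $B$. For a set $\mathcal B$ of formulae, $G$ is $\mathcal B$-free if it has no copy of $B$ for every $B\in\mathcal B$. Theorem. Let $k\ge 1$, let $\mathcal B$ be a finite set of simple $k$-SAT formulae, put $m(\mathcal B)=\max_{B\in\mathcal B}|B|$, and assume $m(\mathcal B)\ge 2$. For every $\delta>0$ there is a constant $C=C(\mathcal B,\delta)>0$ such that for every integer $n\ge 1$ there is a collection $\mathcal G$ of $k$-SAT formulae on the variable set $X=\{x_1,\dots,x_n\}$ with the following properties. (a) Every $\mathcal B$-free $k$-SAT formula with variables in $X$ is a subformula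 of some $G\in\mathcal G$. (b) For every $G\in\mathcal G$ and every $B\in\mathcal B$, $G$ has at most $\delta\, n^{v(B)}$ copies of $B$. (c) $|\mathcal G|\le n^{C n^{k-1/(m(\mathcal B)-1)}}$. -/

import Mathlib

namespace KSat

/-- A literal over the countable pool of variables `ℕ`: `(x, true)` is the positive literal `x`,
`(x, false)` is the negative literal. -/
abbrev Literal := ℕ × Bool

/-- A set of literals, read as their conjunction. -/
abbrev Clause := Finset Literal

/-- A formula is a finite set of clauses. -/
abbrev Formula := Finset Clause

/-- A `k`-clause has exactly `k` literals, on `k` distinct variables. -/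
def Clause.IsKClause (k : ℕ) (c : Clause) : Prop :=
  c.card = k ∧ Set.InjOn Prod.fst (c : Set Literal)

/-- The set of variables used by a clause. -/
def Clause.vars (c : Clause) : Finset ℕ := c.image Prod.fst

/-- A `k`-SAT formula: a set of `k`-clauses. -/
def Formula.IsKSAT (k : ℕ) (F : Formula) : Prop := ∀ c ∈ F, Clause.IsKClause k c

/-- The set of variables that appear in some clause of the formula; its cardinality is `v(F)`. -/
def Formula.vars (F : Formula) : Finset ℕ := F.biUnion Clause.vars

/-- A formula is simple if no two of its clauses use exactly the same set of variables. -/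
def Formula.IsSimple (F : Formula) : Prop :=
  ∀ c ∈ F, ∀ d ∈ F, Clause.vars c = Clause.vars d → c = d

/-- Rename the variable of a literal, keeping its sign. -/
def Literal.relabel (f : ℕ → ℕ) (l : Literal) : Literal := (f l.1, l.2)

/-- Rename the variables of a clause. -/
def Clause.relabel (f : ℕ → ℕ) (c : Clause) : Clause := c.image (Literal.relabel f)

/-- Rename the variables of a formula. -/
def Formula.relabel (f : ℕ → ℕ) (F : Formula) : Formula := F.image (Clause.relabel f)

/-- `F` and `G` are isomorphic if `G` is obtained from `F` by a relabeling of variables that is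
injective on the variables of `F` (hence a bijection from those onto the variables of `G`). -/
def Formula.Isomorphic (F G : Formula) : Prop :=
  ∃ f : ℕ → ℕ, Set.InjOn f (Formula.vars F : Set ℕ) ∧ Formula.relabel f F = G

open scoped Classical in
/-- The copies of `B` in `G`: the subformulae of `G` isomorphic to `B`. -/
noncomputable def Formula.copies (B G : Formula) : Finset Formula :=
  G.powerset.filter (Formula.Isomorphic B)

/-- `G` is `𝓑`-free if it contains no copy of any member of `𝓑`. -/
def Formula.IsFree (𝓑 : Finset Formula) (G : Formula) : Prop :=
  ∀ B ∈ 𝓑, Formula.copies B G = ∅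

/-- `F` is a `k`-SAT formula with variables among `n` variables, named `0, …, n - 1`. -/
def Formula.IsKSATOn (k n : ℕ) (F : Formula) : Prop :=
  Formula.IsKSAT k F ∧ Formula.vars F ⊆ Finset.range n

/-- `m(𝓑)`, the largest number of clauses of a member of `𝓑` (and `0` if `𝓑` is empty). -/
def maxSize (𝓑 : Finset Formula) : ℕ := 𝓑.sup Finset.card

end KSat

/-! ### Containers for weighted uniform hypergraphs -/

namespace HypergraphContainer

open Finset

variable {ι : Type*}

/-! Hypergraph containers: the vertices are the `k`-clauses on `n` variables and the edges are the
copies of a fixed `B`, so `B`-free formulae are independent sets. With `N = 2 ^ k * n ^ k`, `p = n ^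
(-1/(m-1))` and `D` of order `n ^ (v(B) - k)`, a set `T` of clauses has degree at most `D * p ^ (|T|
- 1)`. This is where simplicity enters: two clauses already span `k + 1` variables, which costs a
factor `1/n = p ^ (m-1)`.

The core is `exists_avoided_family`: when the total weight is of order `N * D`, every independent
set `I` misses one of few sets of linear size. Induct on uniformity. Collect links of successive
vertices of `I` into a weight `w'` of uniformity one less, for which `I` stays independent. At each
step either `I` misses all vertices of high degree, or one of them lies in `I` and its link enlarges
`w'`. After about `p * N` steps `w'` is heavy enough for induction. Links may overlap, so edges
carry weights.

Deleting missed sets repeatedly gives `exists_containers`; intersecting over the members of `𝓑`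
gives the theorem. -/

open scoped Classical in
/-- The weight `w` with all edges deleted that contain a member of `S`. -/
noncomputable def prune (S : Set (Finset ι)) (w : Finset ι → ℝ) (e : Finset ι) : ℝ :=
  if ∃ T ∈ S, T ⊆ e then 0 else w e

lemma prune_nonneg {S : Set (Finset ι)} {w : Finset ι → ℝ} (hw : ∀ e, 0 ≤ w e) (e : Finset ι) :
    0 ≤ prune S w e := by
  unfold prune
  split_ifs
  exacts [le_rfl, hw e]

lemma prune_le {S : Set (Finset ι)} {w : Finset ι → ℝ} (hw : ∀ e, 0 ≤ w e) (e : Finset ι) :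
    prune S w e ≤ w e := by
  unfold prune
  split_ifs
  exacts [hw e, le_rfl]

variable [DecidableEq ι]

/-- The total weight of the subsets of `A` that contain `T`. -/
def wdeg (A : Finset ι) (w : Finset ι → ℝ) (T : Finset ι) : ℝ :=
  ∑ e ∈ A.powerset with T ⊆ e, w e

/-- The link of a vertex in a weighted hypergraph. -/
def link (w : Finset ι → ℝ) (v : ι) (f : Finset ι) : ℝ :=
  if v ∈ f then 0 else w (insert v f)

lemma wdeg_eq_sum_ite (A : Finset ι) (w : Finset ι → ℝ) (T : Finset ι) :
    wdeg A w T = ∑ e ∈ A.powerset, if T ⊆ e then w e else 0 := by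
  rw [wdeg, sum_filter]

lemma wdeg_empty (A : Finset ι) (w : Finset ι → ℝ) :
    wdeg A w ∅ = ∑ e ∈ A.powerset, w e := by
  simp [wdeg_eq_sum_ite]

lemma wdeg_nonneg {A : Finset ι} {w : Finset ι → ℝ} (hw : ∀ e, 0 ≤ w e) (T : Finset ι) :
    0 ≤ wdeg A w T :=
  sum_nonneg fun e _ => hw e

lemma wdeg_mono {A : Finset ι} {u w : Finset ι → ℝ} (h : ∀ e, u e ≤ w e) (T : Finset ι) :
    wdeg A u T ≤ wdeg A w T :=
  sum_le_sum fun e _ => h e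

lemma wdeg_add (A : Finset ι) (u w : Finset ι → ℝ) (T : Finset ι) :
    wdeg A (fun e => u e + w e) T = wdeg A u T + wdeg A w T := by
  simp [wdeg, sum_add_distrib]

lemma wdeg_link_of_mem (A : Finset ι) (w : Finset ι → ℝ) {v : ι} {T : Finset ι} (hv : v ∈ T) :
    wdeg A (link w v) T = 0 := by
  refine sum_eq_zero fun e he => ?_
  simp [link, (mem_filter.1 he).2 hv]

lemma wdeg_link_of_notMem {A : Finset ι} (w : Finset ι → ℝ) {v : ι} {T : Finset ι}
    (hvA : v ∈ A) (hv : v ∉ T) :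
    wdeg A (link w v) T = wdeg A w (insert v T) := by
  unfold wdeg link
  rw [sum_ite, sum_const_zero, zero_add]
  refine sum_bij' (fun f _ => insert v f) (fun e _ => e.erase v) ?_ ?_ ?_ ?_ ?_
  · intro f hf
    simp only [mem_filter, mem_powerset] at hf ⊢
    exact ⟨insert_subset hvA hf.1.1, insert_subset_insert v hf.1.2⟩
  · intro e he
    simp only [mem_filter, mem_powerset] at he ⊢
    exact ⟨⟨(erase_subset v e).trans he.1,
      subset_erase.2 ⟨(subset_insert v T).trans he.2, hv⟩⟩, notMem_erase v e⟩
  · intro f hf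
    simp only [mem_filter] at hf
    exact erase_insert hf.2
  · intro e he
    simp only [mem_filter] at he
    exact insert_erase (he.2 (mem_insert_self v T))
  · intro f _
    rfl

lemma wdeg_link_prune_eq_zero (A : Finset ι) {S : Set (Finset ι)} (w : Finset ι → ℝ) (v : ι)
    {T : Finset ι} (hT : T ∈ S) : wdeg A (link (prune S w) v) T = 0 := by
  refine sum_eq_zero fun e he => ?_
  have hTe : T ⊆ insert v e := ((mem_filter.1 he).2).trans (subset_insert v e)
  unfold link
  split_ifs
  · rfl
  · exact if_pos ⟨T, hT, hTe⟩

-- Union bound: each deleted edge contains some `T ∈ S` and is paid for by the degree of that `T`.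
open scoped Classical in
lemma wdeg_le_prune_add (A : Finset ι) (S : Set (Finset ι)) {w : Finset ι → ℝ}
    (hw : ∀ e, 0 ≤ w e) :
    wdeg A w ∅ ≤ wdeg A (prune S w) ∅ + ∑ T ∈ A.powerset with T ∈ S, wdeg A w T := by
  simp only [wdeg_eq_sum_ite A w]
  rw [sum_comm, wdeg_empty, ← sum_add_distrib]
  refine sum_le_sum fun e he => ?_
  simp only [empty_subset, if_true]
  have hnn : ∀ T ∈ A.powerset.filter (· ∈ S), 0 ≤ if T ⊆ e then w e else 0 := by
    intro T _
    split_ifs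
    exacts [hw e, le_rfl]
  by_cases h : ∃ T ∈ S, T ⊆ e
  · obtain ⟨T, hTS, hTe⟩ := h
    have h1 := single_le_sum hnn
      (mem_filter.2 ⟨mem_powerset.2 (hTe.trans (mem_powerset.1 he)), hTS⟩)
    rw [if_pos hTe] at h1
    linarith [prune_nonneg (S := S) hw e]
  · have h1 := sum_nonneg hnn
    have h2 : prune S w e = w e := if_neg h
    linarith

/-- Double counting: an edge of size `s` is counted once for each of its subsets. -/
lemma sum_wdeg_powerset {A : Finset ι} {w : Finset ι → ℝ} {s : ℕ}
    (hs : ∀ e, w e ≠ 0 → e.card = s) :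
    ∑ T ∈ A.powerset, wdeg A w T = 2 ^ s * wdeg A w ∅ := by
  simp only [wdeg_eq_sum_ite A w]
  rw [sum_comm, mul_sum]
  refine sum_congr rfl fun e he => ?_
  rw [← sum_filter, sum_const, nsmul_eq_mul, if_pos (empty_subset e)]
  by_cases h : w e = 0
  · simp [h]
  · have : A.powerset.filter (· ⊆ e) = e.powerset := by
      ext T
      simp only [mem_filter, mem_powerset]
      exact ⟨fun h => h.2, fun h => ⟨h.trans (mem_powerset.1 he), h⟩⟩
    rw [this, card_powerset, hs e h]
    push_cast
    rfl

lemma sum_wdeg_singleton {A : Finset ι} {w : Finset ι → ℝ} {s : ℕ}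
    (hs : ∀ e, w e ≠ 0 → e.card = s) :
    ∑ v ∈ A, wdeg A w {v} = s * wdeg A w ∅ := by
  simp only [wdeg_eq_sum_ite A w]
  rw [sum_comm, mul_sum]
  refine sum_congr rfl fun e he => ?_
  rw [← sum_filter, sum_const, nsmul_eq_mul, if_pos (empty_subset e)]
  by_cases h : w e = 0
  · simp [h]
  · have : A.filter (fun v => {v} ⊆ e) = e := by
      ext v
      simp only [mem_filter, singleton_subset_iff]
      exact ⟨fun h => h.2, fun h => ⟨mem_powerset.1 he h, h⟩⟩
    rw [this, hs e h]

/-! ### Independent sets and the sets they avoid -/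

/-- A set of vertices is independent if it contains no edge of non-zero weight. -/
def Independent (w : Finset ι → ℝ) (I : Finset ι) : Prop := ∀ e ⊆ I, w e = 0

lemma Independent.link {w w' : Finset ι → ℝ} {I : Finset ι} (S : Set (Finset ι)) {v : ι}
    (h : Independent w I) (h' : Independent w' I) (hv : v ∈ I) :
    Independent (fun e => w' e + link (prune S w) v e) I := by
  intro e he
  have h1 : w (insert v e) = 0 := h _ (insert_subset hv he)
  simp [h' e he, HypergraphContainer.link, prune, h1]

/-- If the total degree is large then many vertices have a large degree. -/
lemma card_high_degree {A : Finset ι} {N : ℕ} {D a : ℝ} {u : Finset ι → ℝ}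
    (hAN : A.card ≤ N) (hD : 0 < D) (ha : 0 < a) (hdeg : ∀ v ∈ A, wdeg A u {v} ≤ D)
    (hsum : a / 2 * N * D ≤ ∑ v ∈ A, wdeg A u {v}) :
    a / 4 * N ≤ ((A.filter fun v => a / 4 * D ≤ wdeg A u {v}).card : ℝ) := by
  set Z := A.filter fun v => a / 4 * D ≤ wdeg A u {v} with hZ
  have h1 : ∑ v ∈ A, wdeg A u {v} ≤ Z.card * D + N * (a / 4 * D) := by
    rw [← sum_filter_add_sum_filter_not A (fun v => a / 4 * D ≤ wdeg A u {v})]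
    refine add_le_add ?_ ?_
    · have := sum_le_card_nsmul Z (fun v => wdeg A u {v}) D
        fun v hv => hdeg v (mem_filter.1 hv).1
      simpa using this
    · refine (sum_le_card_nsmul _ _ (a / 4 * D) fun v hv =>
        (not_le.1 (mem_filter.1 hv).2).le).trans ?_
      rw [nsmul_eq_mul]
      refine mul_le_mul_of_nonneg_right ?_ (by positivity)
      exact_mod_cast (card_filter_le _ _).trans hAN
  have h2 : a / 4 * N * D ≤ Z.card * D := by linarith
  exact le_of_mul_le_mul_right h2 hD

/-- In a weighted uniform hypergraph with controlled degrees, every independent set avoids a member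
of a small family of large vertex sets. -/
theorem exists_avoided_family (s : ℕ) : ∀ a : ℝ, 0 < a → ∃ c : ℝ, 0 < c ∧
    ∀ (A : Finset ι) (N : ℕ) (p D : ℝ) (w : Finset ι → ℝ), A.card ≤ N → 0 < N → 0 < p → 0 < D →
      (∀ e, 0 ≤ w e) → (∀ e, w e ≠ 0 → e.card = s) →
      (∀ T : Finset ι, T.Nonempty → wdeg A w T ≤ D * p ^ (T.card - 1)) →
      a * N * D ≤ wdeg A w ∅ →
      ∃ 𝓩 : Finset (Finset ι), 𝓩.card ≤ (N + 1) ^ (s * ⌈p * N⌉₊) ∧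
        (∀ Z ∈ 𝓩, Z ⊆ A ∧ c * N ≤ Z.card) ∧
        ∀ I ⊆ A, Independent w I → ∃ Z ∈ 𝓩, Disjoint Z I := by
  induction s with
  | zero =>
    intro a ha
    refine ⟨1, one_pos, fun A N p D w _ hN _ hD _ hs _ hW => ⟨∅, by simp, by simp, ?_⟩⟩
    -- The only possible edge is `∅`, which lies in every set; positive total weight rules out
    -- independent sets.
    intro I _ hI
    exfalso
    have h0 : wdeg A w ∅ = 0 := by
      rw [wdeg_empty]
      refine sum_eq_zero fun e _ => by_contra fun h => h ?_
      rw [card_eq_zero.1 (hs e h)]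
      exact hI ∅ (empty_subset I)
    have : 0 < a * N * D := by positivity
    linarith
  | succ s ih =>
    intro a ha
    -- `2 ^ s * η = 1/4` limits the loss from pruning to a quarter of `a * N * D`; `η ≤ 1/4` makes
    -- `⌈p * N⌉₊` gains of `a / 4 * D` enough.
    set η : ℝ := 1 / 2 ^ (s + 2) with hη
    have hη0 : 0 < η := by positivity
    have hη1 : 2 ^ s * η = 1 / 4 := by
      rw [hη]; field_simp; ring
    have hη2 : η ≤ 1 / 4 := by
      have : (1 : ℝ) ≤ 2 ^ s := one_le_pow₀ (by norm_num)
      nlinarith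
    -- The induction runs at degree scale `2 * D * p`, so the factor `2` is divided out of the
    -- density.
    obtain ⟨c, hc, hrec⟩ := ih (η * a / 2) (by positivity)
    refine ⟨min (a / 4) c, lt_min (by positivity) hc, ?_⟩
    intro A N p D w hAN hN hp hD hw hs hdeg hW
    set M := (N + 1) ^ (s * ⌈p * N⌉₊) with hM
    have hM1 : 1 ≤ M := Nat.one_le_pow _ _ (Nat.succ_pos N)
    have hterminal : ∀ w' : Finset ι → ℝ, (∀ e, 0 ≤ w' e) → (∀ e, w' e ≠ 0 → e.card = s) →
        (∀ T : Finset ι, T.Nonempty → wdeg A w' T ≤ 2 * D * p ^ T.card) →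
        η * a * N * D * p ≤ wdeg A w' ∅ →
        ∃ 𝓩 : Finset (Finset ι), 𝓩.card ≤ M ∧
        (∀ Z ∈ 𝓩, Z ⊆ A ∧ min (a / 4) c * N ≤ Z.card) ∧
        ∀ I ⊆ A, Independent w' I → ∃ Z ∈ 𝓩, Disjoint Z I := by
      intro w' hw' hs' hdeg' hW'
      obtain ⟨𝓩, h1, h2, h3⟩ := hrec A N p (2 * D * p) w' hAN hN hp (by positivity) hw' hs'
        (fun T hT => by
          refine (hdeg' T hT).trans (le_of_eq ?_)
          obtain ⟨j, hj⟩ := Nat.exists_eq_add_of_lt hT.card_pos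
          rw [hj]
          simp only [zero_add, Nat.add_sub_cancel]
          ring)
        (by linarith)
      refine ⟨𝓩, h1, fun Z hZ => ⟨(h2 Z hZ).1, le_trans ?_ (h2 Z hZ).2⟩, h3⟩
      exact mul_le_mul_of_nonneg_right (min_le_right _ _) (Nat.cast_nonneg N)
    -- `t` counts the steps still available, each worth at least `a / 4 * D` of weight in `w'`.
    have hmain : ∀ t : ℕ, ∀ w' : Finset ι → ℝ, (∀ e, 0 ≤ w' e) → (∀ e, w' e ≠ 0 → e.card = s) →
        (∀ T : Finset ι, T.Nonempty → wdeg A w' T ≤ 2 * D * p ^ T.card) →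
        η * a * N * D * p - t * (a / 4 * D) ≤ wdeg A w' ∅ →
        ∃ 𝓩 : Finset (Finset ι), 𝓩.card ≤ (N + 1) ^ t * M ∧
        (∀ Z ∈ 𝓩, Z ⊆ A ∧ min (a / 4) c * N ≤ Z.card) ∧
        ∀ I ⊆ A, Independent w I → Independent w' I → ∃ Z ∈ 𝓩, Disjoint Z I := by
      intro t
      induction t with
      | zero =>
        intro w' hw' hs' hdeg' hW'
        obtain ⟨𝓩, h1, h2, h3⟩ := hterminal w' hw' hs' hdeg' (by simpa using hW')
        exact ⟨𝓩, by simpa using h1, h2, fun I hI _ hI' => h3 I hI hI'⟩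
      | succ t iht =>
        intro w' hw' hs' hdeg' hW'
        rcases le_or_gt (η * a * N * D * p) (wdeg A w' ∅) with hbig | hsmall
        · obtain ⟨𝓩, h1, h2, h3⟩ := hterminal w' hw' hs' hdeg' hbig
          exact ⟨𝓩, h1.trans (Nat.le_mul_of_pos_left M (by positivity)), h2,
            fun I hI _ hI' => h3 I hI hI'⟩
        -- `S` holds the saturated sets: those whose degree in `w'` exceeds half of the permitted `2
        -- * D * p ^ T.card`.
        obtain ⟨S, hS⟩ : ∃ S : Set (Finset ι), ∀ T, T ∈ S ↔
            T.Nonempty ∧ D * p ^ T.card < wdeg A w' T := ⟨{T | _}, fun _ => Iff.rfl⟩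
        set u := prune S w with hu
        have hu0 : ∀ e, 0 ≤ u e := prune_nonneg hw
        have huw : ∀ e, u e ≤ w e := prune_le hw
        have hus : ∀ e, u e ≠ 0 → e.card = s + 1 := fun e he => hs e fun h =>
          he (le_antisymm ((huw e).trans h.le) (hu0 e))
        -- A saturated set has degree in `w` at most `1/p` times its degree in `w'`. The latter
        -- degrees sum to at most `2 ^ s` times the total of `w'`, which is small here.
        have hkill : a / 2 * N * D ≤ wdeg A u ∅ := by
          classical
          have h1 := wdeg_le_prune_add A S hw
          have h2 : ∑ T ∈ A.powerset with T ∈ S, wdeg A w T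
              ≤ ∑ T ∈ A.powerset, wdeg A w' T / p := by
            refine (sum_le_sum fun T hT => ?_).trans
              (sum_le_sum_of_subset_of_nonneg (filter_subset _ _)
                fun T _ _ => div_nonneg (wdeg_nonneg hw' T) hp.le)
            obtain ⟨hne, hlt⟩ : T.Nonempty ∧ D * p ^ T.card < wdeg A w' T :=
              (hS T).1 (mem_filter.1 hT).2
            rw [le_div_iff₀ hp]
            refine (mul_le_mul_of_nonneg_right (hdeg T hne) hp.le).trans 
              (le_trans (le_of_eq ?_) hlt.le)
            rw [mul_assoc, ← pow_succ, Nat.sub_add_cancel hne.card_pos]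
          rw [← sum_div, sum_wdeg_powerset hs'] at h2
          have h3 : 2 ^ s * wdeg A w' ∅ / p ≤ a / 4 * N * D := by
            rw [div_le_iff₀ hp]
            calc 2 ^ s * wdeg A w' ∅ ≤ 2 ^ s * (η * a * N * D * p) :=
                  mul_le_mul_of_nonneg_left hsmall.le (by positivity)
              _ = (2 ^ s * η) * (a * N * D * p) := by ring
              _ = a / 4 * N * D * p := by rw [hη1]; ring
          have h4 : 0 < a * N * D := by positivity
          linarith
        set Z₀ := A.filter fun v => a / 4 * D ≤ wdeg A u {v} with hZ₀
        have hZ₀card : a / 4 * N ≤ (Z₀.card : ℝ) := by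
          refine card_high_degree hAN hD ha (fun v _ => ?_) ?_
          · simpa using (wdeg_mono huw {v}).trans (hdeg {v} (singleton_nonempty v))
          · rw [sum_wdeg_singleton hus]
            refine hkill.trans (le_mul_of_one_le_left (wdeg_nonneg hu0 ∅) ?_)
            push_cast
            linarith [Nat.cast_nonneg (α := ℝ) s]
        have hbranch : ∀ v ∈ Z₀, ∃ 𝓩 : Finset (Finset ι), 𝓩.card ≤ (N + 1) ^ t * M ∧
            (∀ Z ∈ 𝓩, Z ⊆ A ∧ min (a / 4) c * N ≤ Z.card) ∧
            ∀ I ⊆ A, Independent w I → Independent w' I → v ∈ I → ∃ Z ∈ 𝓩, Disjoint Z I := by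
          intro v hv
          obtain ⟨hvA, hvdeg⟩ := mem_filter.1 hv
          have hl0 : ∀ e, 0 ≤ link u v e := by
            intro e
            unfold link
            split_ifs
            exacts [le_rfl, hu0 _]
          obtain ⟨𝓩, h1, h2, h3⟩ := iht (fun e => w' e + link u v e)
            (fun e => add_nonneg (hw' e) (hl0 e))
            (fun e he => by
              by_cases h : w' e = 0
              · simp only [h, zero_add, link] at he
                split_ifs at he with hve
                · exact absurd rfl he
                · have := hus _ he
                  rw [card_insert_of_notMem hve] at this
                  omega
              · exact hs' e h)
            (fun T hT => by
              rw [wdeg_add]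
              -- A saturated set gains nothing from a link of the pruned weight; any other has at
              -- most half its cap and gains at most the other half.
              by_cases hTS : T ∈ S
              · rw [hu, wdeg_link_prune_eq_zero A w v hTS, add_zero]
                exact hdeg' T hT
              · have hle : wdeg A w' T ≤ D * p ^ T.card := not_lt.1 fun h => hTS ((hS T).2 ⟨hT, h⟩)
                have hle' : wdeg A (link u v) T ≤ D * p ^ T.card := by
                  by_cases hvT : v ∈ T
                  · rw [wdeg_link_of_mem A u hvT]
                    positivity
                  · rw [wdeg_link_of_notMem u hvA hvT]
                    have := (wdeg_mono huw (insert v T)).trans (hdeg _ (insert_nonempty v T))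
                    rwa [card_insert_of_notMem hvT, Nat.add_sub_cancel] at this
                linarith)
            (by
              rw [wdeg_add, wdeg_link_of_notMem u hvA (notMem_empty v)]
              change _ ≤ _ + wdeg A u {v}
              push_cast at hW'
              linarith)
          exact ⟨𝓩, h1, h2, fun I hI hIw hIw' hvI => h3 I hI hIw (hIw.link S hIw' hvI)⟩
        choose! 𝓕 hF1 hF2 hF3 using hbranch
        -- Either `I` misses `Z₀`, or some `v ∈ Z₀ ∩ I` selects a branch; there are at most `N`
        -- branches.
        refine ⟨insert Z₀ (Z₀.biUnion 𝓕), ?_, ?_, ?_⟩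
        · calc (insert Z₀ (Z₀.biUnion 𝓕)).card ≤ (Z₀.biUnion 𝓕).card + 1 := card_insert_le _ _
            _ ≤ Z₀.card * ((N + 1) ^ t * M) + 1 :=
                Nat.add_le_add_right (card_biUnion_le_card_mul _ _ _ hF1) 1
            _ ≤ N * ((N + 1) ^ t * M) + (N + 1) ^ t * M := by
                refine Nat.add_le_add (Nat.mul_le_mul_right _
                  ((card_filter_le _ _).trans hAN)) ?_
                exact Nat.mul_pos (by positivity) hM1
            _ = (N + 1) ^ (t + 1) * M := by ring
        · intro Z hZ
          rcases mem_insert.1 hZ with rfl | hZ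
          · refine ⟨filter_subset _ _, le_trans ?_ hZ₀card⟩
            exact mul_le_mul_of_nonneg_right (min_le_left _ _) (Nat.cast_nonneg N)
          · obtain ⟨v, hv, hZv⟩ := mem_biUnion.1 hZ
            exact hF2 v hv Z hZv
        · intro I hI hIw hIw'
          by_cases h : Disjoint Z₀ I
          · exact ⟨Z₀, mem_insert_self _ _, h⟩
          · obtain ⟨v, hv, hvI⟩ := not_disjoint_iff.1 h
            obtain ⟨Z, hZ, hZI⟩ := hF3 v hv I hI hIw hIw' hvI
            exact ⟨Z, mem_insert_of_mem (mem_biUnion.2 ⟨v, hv, hZ⟩), hZI⟩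
    obtain ⟨𝓩, h1, h2, h3⟩ := hmain ⌈p * N⌉₊ (fun _ => 0) (fun _ => le_rfl)
      (fun e he => absurd rfl he)
      (fun T _ => by
        have : wdeg A (fun _ => (0 : ℝ)) T = 0 := sum_const_zero
        rw [this]
        positivity)
      (by
        have h0 : wdeg A (fun _ => (0 : ℝ)) ∅ = 0 := sum_const_zero
        have h1 : p * N ≤ ⌈p * N⌉₊ := Nat.le_ceil _
        have h2 : η * a * N * D * p ≤ (p * N) * (a / 4 * D) := by
          have : 0 ≤ a * N * D * p := by positivity
          nlinarith
        have h3 : (p * N) * (a / 4 * D) ≤ ⌈p * N⌉₊ * (a / 4 * D) :=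
          mul_le_mul_of_nonneg_right h1 (by positivity)
        rw [h0]
        linarith)
    refine ⟨𝓩, h1.trans (le_of_eq ?_), h2, fun I hI hIw => h3 I hI hIw fun _ _ => rfl⟩
    rw [hM]
    ring

lemma wdeg_le_of_subset {A C : Finset ι} {w : Finset ι → ℝ} (hw : ∀ e, 0 ≤ w e) (hCA : C ⊆ A)
    (T : Finset ι) : wdeg C w T ≤ wdeg A w T :=
  sum_le_sum_of_subset_of_nonneg (filter_subset_filter _ (powerset_mono.2 hCA)) fun e _ _ => hw e

/-! ### Containers by repeated deletion -/

/-- Containers for weighted uniform hypergraphs: independent sets are covered by few sets, each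
spanning a small weight. -/
theorem exists_containers (s : ℕ) (a : ℝ) (ha : 0 < a) : ∃ R : ℕ,
    ∀ (A : Finset ι) (N : ℕ) (p D : ℝ) (w : Finset ι → ℝ), A.card ≤ N → 0 < N → 0 < p → 0 < D →
      (∀ e, 0 ≤ w e) → (∀ e, w e ≠ 0 → e.card = s) →
      (∀ T : Finset ι, T.Nonempty → wdeg A w T ≤ D * p ^ (T.card - 1)) →
      ∃ 𝓒 : Finset (Finset ι), 𝓒.card ≤ (N + 1) ^ (R * ⌈p * N⌉₊) ∧
        (∀ C ∈ 𝓒, C ⊆ A ∧ wdeg C w ∅ ≤ a * N * D) ∧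
        ∀ I ⊆ A, Independent w I → ∃ C ∈ 𝓒, I ⊆ C := by
  obtain ⟨c, hc, hfam⟩ := exists_avoided_family (ι := ι) s a ha
  -- Each deletion removes at least `c * N` of at most `N` vertices, so the process stops within
  -- `t₀` rounds.
  obtain ⟨t₀, ht₀⟩ := exists_nat_gt (1 / c)
  refine ⟨t₀ * s, ?_⟩
  intro A N p D w hAN hN hp hD hw hs hdeg
  set M := (N + 1) ^ (s * ⌈p * N⌉₊) with hM
  have hM1 : 1 ≤ M := Nat.one_le_pow _ _ (Nat.succ_pos N)
  have hmain : ∀ t : ℕ, ∀ C ⊆ A, (C.card : ℝ) < t * (c * N) →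
      ∃ 𝓒 : Finset (Finset ι), 𝓒.card ≤ M ^ t ∧
        (∀ C' ∈ 𝓒, C' ⊆ C ∧ wdeg C' w ∅ ≤ a * N * D) ∧
        ∀ I ⊆ C, Independent w I → ∃ C' ∈ 𝓒, I ⊆ C' := by
    intro t
    induction t with
    | zero =>
      intro C _ hC
      have : (0 : ℝ) ≤ C.card := Nat.cast_nonneg _
      simp only [Nat.cast_zero, zero_mul] at hC
      linarith
    | succ t iht =>
      intro C hCA hC
      rcases le_or_gt (wdeg C w ∅) (a * N * D) with hle | hgt
      · exact ⟨{C}, by simpa using Nat.one_le_pow _ _ hM1, by simpa using hle,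
          fun I hI _ => ⟨C, mem_singleton_self C, hI⟩⟩
      obtain ⟨𝓩, h1, h2, h3⟩ := hfam C N p D w ((card_le_card hCA).trans hAN) hN hp hD hw hs
        (fun T hT => (wdeg_le_of_subset hw hCA T).trans (hdeg T hT)) hgt.le
      have hbranch : ∀ Z ∈ 𝓩, ∃ 𝓒 : Finset (Finset ι), 𝓒.card ≤ M ^ t ∧
          (∀ C' ∈ 𝓒, C' ⊆ C \ Z ∧ wdeg C' w ∅ ≤ a * N * D) ∧
          ∀ I ⊆ C \ Z, Independent w I → ∃ C' ∈ 𝓒, I ⊆ C' := by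
        intro Z hZ
        refine iht (C \ Z) (sdiff_subset.trans hCA) ?_
        have h4 : ((C \ Z).card : ℝ) + Z.card = C.card := by
          exact_mod_cast card_sdiff_add_card_eq_card (h2 Z hZ).1
        have h5 := (h2 Z hZ).2
        push_cast at hC
        linarith
      choose! 𝓕 hF1 hF2 hF3 using hbranch
      refine ⟨𝓩.biUnion 𝓕, ?_, ?_, ?_⟩
      · rw [pow_succ']
        exact (card_biUnion_le_card_mul _ _ _ hF1).trans (Nat.mul_le_mul_right _ h1)
      · intro C' hC'
        obtain ⟨Z, hZ, hCZ⟩ := mem_biUnion.1 hC'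
        exact ⟨(hF2 Z hZ C' hCZ).1.trans sdiff_subset, (hF2 Z hZ C' hCZ).2⟩
      · intro I hI hIw
        obtain ⟨Z, hZ, hZI⟩ := h3 I hI hIw
        obtain ⟨C', hC', hIC'⟩ := hF3 Z hZ I (subset_sdiff.2 ⟨hI, hZI.symm⟩) hIw
        exact ⟨C', mem_biUnion.2 ⟨Z, hZ, hC'⟩, hIC'⟩
  obtain ⟨𝓒, h1, h2, h3⟩ := hmain t₀ A Subset.rfl (by
    have hN' : (0 : ℝ) < N := Nat.cast_pos.2 hN
    have h4 : 1 < t₀ * c := (div_lt_iff₀ hc).1 ht₀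
    have h5 : (A.card : ℝ) ≤ N := by exact_mod_cast hAN
    nlinarith)
  refine ⟨𝓒, h1.trans (le_of_eq ?_), h2, h3⟩
  rw [hM, ← pow_mul]
  congr 1
  ring

end HypergraphContainer

/-! ### Copies of a formula -/

namespace KSat

open Finset HypergraphContainer

/-- The number of functions whose range contains a prescribed set. -/
lemma card_range_superset_mul_le {α β σ : Type*} [Fintype α] [Fintype β] [Fintype σ]
    [DecidableEq α] [DecidableEq β] [DecidableEq σ] (j : σ → β) (hj : Function.Injective j) :
    #{φ : α → β | ∀ s, ∃ a, φ a = j s} * Fintype.card β ^ Fintype.card σ ≤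
      Fintype.card α ^ Fintype.card σ * Fintype.card β ^ Fintype.card α := by
  classical
  have hpre : ∀ φ : {φ : α → β // ∀ s, ∃ a, φ a = j s}, ∃ g : σ → α, ∀ s, φ.1 (g s) = j s :=
    fun φ => ⟨fun s => (φ.2 s).choose, fun s => (φ.2 s).choose_spec⟩
  choose g hg using hpre
  have hginj : ∀ φ, Function.Injective (g φ) := fun φ s t h =>
    hj (by rw [← hg φ s, ← hg φ t, h])
  -- Encode `(φ, h)` by a choice `g` of preimages of `j` and by `φ` overwritten with `h` on the
  -- range of `g`. The overwritten values of `φ` are recovered from `j`.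
  have hcard := Fintype.card_le_of_injective
    (fun x : {φ : α → β // ∀ s, ∃ a, φ a = j s} × (σ → β) =>
      ((g x.1, Function.extend (g x.1) x.2 x.1.1) : (σ → α) × (α → β))) (by
    rintro ⟨φ, h⟩ ⟨φ', h'⟩ heq
    obtain ⟨hgg, hext⟩ := Prod.mk.inj heq
    simp only at hgg hext
    have hh : h = h' := by
      ext1 s
      have h1 := congrFun hext (g φ s)
      rw [(hginj φ).extend_apply, hgg, (hginj φ').extend_apply] at h1
      exact h1
    have hφ : φ = φ' := by
      ext1
      ext1 x
      by_cases hx : ∃ s, g φ s = x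
      · obtain ⟨s, rfl⟩ := hx
        rw [hg, hgg, hg]
      · have h1 := congrFun hext x
        rwa [Function.extend_apply' _ _ _ hx, Function.extend_apply' _ _ _ (hgg ▸ hx)] at h1
    rw [hh, hφ])
  simpa [Fintype.card_subtype] using hcard

lemma mem_copies {B G e : Formula} :
    e ∈ Formula.copies B G ↔ e ⊆ G ∧ Formula.Isomorphic B e := by
  simp [Formula.copies]

lemma copies_mono (B : Formula) {F G : Formula} (h : F ⊆ G) :
    Formula.copies B F ⊆ Formula.copies B G := fun e he => by
  rw [mem_copies] at he ⊢
  exact ⟨he.1.trans h, he.2⟩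

lemma vars_subset_of_mem {B : Formula} {c : Clause} (hc : c ∈ B) :
    Clause.vars c ⊆ Formula.vars B :=
  subset_biUnion_of_mem Clause.vars hc

lemma vars_mono {F G : Formula} (h : F ⊆ G) : Formula.vars F ⊆ Formula.vars G :=
  biUnion_subset_biUnion_of_subset_left _ h

lemma Clause.vars_relabel (f : ℕ → ℕ) (c : Clause) :
    Clause.vars (Clause.relabel f c) = (Clause.vars c).image f := by
  simp only [Clause.vars, Clause.relabel, image_image]
  rfl

lemma Formula.vars_relabel (f : ℕ → ℕ) (B : Formula) :
    Formula.vars (Formula.relabel f B) = (Formula.vars B).image f := by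
  simp only [Formula.vars, Formula.relabel, image_biUnion, biUnion_image, Clause.vars_relabel]

lemma Clause.card_vars {k : ℕ} {c : Clause} (hc : Clause.IsKClause k c) :
    (Clause.vars c).card = k := by
  rw [Clause.vars, card_image_of_injOn hc.2, hc.1]

lemma Formula.relabel_congr {f g : ℕ → ℕ} {B : Formula}
    (h : ∀ x ∈ Formula.vars B, f x = g x) : Formula.relabel f B = Formula.relabel g B := by
  refine image_congr fun c hc => image_congr fun l hl => ?_
  have hl' : l.1 ∈ Formula.vars B := vars_subset_of_mem hc (mem_image_of_mem Prod.fst hl)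
  simp [Literal.relabel, h _ hl']

/-- In a simple formula, clauses are determined by the image of their variables. -/
lemma Formula.IsSimple.eq_of_image_vars_eq {B : Formula} (hB : Formula.IsSimple B) {f : ℕ → ℕ}
    (hf : Set.InjOn f (Formula.vars B : Set ℕ)) {c d : Clause} (hc : c ∈ B) (hd : d ∈ B)
    (h : (Clause.vars c).image f = (Clause.vars d).image f) : c = d := by
  refine hB c hc d hd ?_
  have hc' := vars_subset_of_mem hc
  have hd' := vars_subset_of_mem hd
  refine coe_injective ((hf.image_eq_image_iff (coe_subset.2 hc') (coe_subset.2 hd')).1 ?_)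
  exact_mod_cast h

lemma Formula.IsSimple.of_isomorphic {B e : Formula} (hB : Formula.IsSimple B)
    (h : Formula.Isomorphic B e) : Formula.IsSimple e := by
  obtain ⟨f, hf, rfl⟩ := h
  intro c hc d hd hcd
  obtain ⟨c', hc', rfl⟩ := mem_image.1 hc
  obtain ⟨d', hd', rfl⟩ := mem_image.1 hd
  rw [Clause.vars_relabel, Clause.vars_relabel] at hcd
  rw [hB.eq_of_image_vars_eq hf hc' hd' hcd]

lemma Formula.IsSimple.card_eq_of_isomorphic {B e : Formula} (hB : Formula.IsSimple B)
    (h : Formula.Isomorphic B e) : e.card = B.card := by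
  obtain ⟨f, hf, rfl⟩ := h
  refine card_image_of_injOn fun c hc d hd hcd => hB.eq_of_image_vars_eq hf hc hd ?_
  rw [← Clause.vars_relabel, ← Clause.vars_relabel, hcd]

/-! ### Degrees in the hypergraph of copies -/

open scoped Classical in
/-- All `k`-clauses on the variables `0, …, n - 1`. -/
noncomputable def allClauses (k n : ℕ) : Finset Clause :=
  {c ∈ (range n ×ˢ (univ : Finset Bool)).powerset | Clause.IsKClause k c}

lemma mem_allClauses {k n : ℕ} {c : Clause} :
    c ∈ allClauses k n ↔ Clause.vars c ⊆ range n ∧ Clause.IsKClause k c := by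
  simp only [allClauses, mem_filter, mem_powerset, Clause.vars, image_subset_iff]
  refine and_congr_left fun _ => ⟨fun h l hl => (mem_product.1 (h hl)).1,
    fun h l hl => mem_product.2 ⟨h l hl, mem_univ _⟩⟩

lemma subset_allClauses_iff {k n : ℕ} {F : Formula} :
    F ⊆ allClauses k n ↔ Formula.IsKSATOn k n F := by
  simp only [Formula.IsKSATOn, Formula.IsKSAT, Formula.vars, biUnion_subset, subset_iff (s₁ := F),
    mem_allClauses]
  exact ⟨fun h => ⟨fun c hc => (h hc).2, fun c hc => (h hc).1⟩,
    fun h c hc => ⟨h.2 c hc, h.1 c hc⟩⟩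

lemma card_allClauses_le (k n : ℕ) : (allClauses k n).card ≤ 2 ^ k * n ^ k := by
  classical
  have h : allClauses k n ⊆ powersetCard k (range n ×ˢ (univ : Finset Bool)) := fun c hc => by
    simp only [allClauses, mem_filter, mem_powerset] at hc
    exact mem_powersetCard.2 ⟨hc.1, hc.2.1⟩
  refine (card_le_card h).trans ?_
  rw [card_powersetCard, card_product, card_range, card_univ, Fintype.card_bool, ← mul_pow,
    mul_comm 2 n]
  exact Nat.choose_le_pow _ _

/-- The number of copies of `B` on `n` variables that use all variables of a given set. -/
lemma card_copies_mul_le (k n : ℕ) (B : Formula) (T : Formula) (S : Finset ℕ)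
    (hS : S ⊆ Formula.vars T) (hT : Formula.vars T ⊆ range n) :
    #{e ∈ Formula.copies B (allClauses k n) | T ⊆ e} * n ^ S.card ≤
      (Formula.vars B).card ^ S.card * n ^ (Formula.vars B).card := by
  classical
  have hlt : ∀ s : S, s.1 < n := fun s => mem_range.1 (hT (hS s.2))
  let j : S → Fin n := fun s => ⟨s.1, hlt s⟩
  have hj : Function.Injective j := fun s t h => Subtype.ext (Fin.mk.inj h)
  have h1 := card_range_superset_mul_le (α := Formula.vars B) j hj
  simp only [Fintype.card_coe, Fintype.card_fin] at h1
  refine (Nat.mul_le_mul_right _ ?_).trans h1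
  -- A copy depends only on the relabeling of the variables of `B`; the value `0` elsewhere is
  -- immaterial.
  refine (card_le_card ?_).trans (card_image_le (f := fun φ : Formula.vars B → Fin n =>
    Formula.relabel (fun x => if h : x ∈ Formula.vars B then (φ ⟨x, h⟩ : ℕ) else 0) B))
  intro e he
  obtain ⟨he1, hTe⟩ := mem_filter.1 he
  obtain ⟨heA, f, hf, rfl⟩ := mem_copies.1 he1
  have hvars := (subset_allClauses_iff.1 heA).2
  have hvars' := hS.trans (vars_mono hTe)
  rw [Formula.vars_relabel] at hvars hvars'
  refine mem_image.2 ⟨fun x => ⟨f x.1, mem_range.1 (hvars (mem_image_of_mem f x.2))⟩, ?_, ?_⟩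
  · refine mem_filter.2 ⟨mem_univ _, fun s => ?_⟩
    obtain ⟨x, hx, hxs⟩ := mem_image.1 (hvars' s.2)
    exact ⟨⟨x, hx⟩, Fin.ext hxs⟩
  · refine Formula.relabel_congr fun x hx => ?_
    simp [hx]

/-- Two different clauses of a simple formula of `k`-clauses use more than `k` variables. -/
lemma lt_card_vars {k : ℕ} {T e : Formula} (hT : 2 ≤ T.card) (hTe : T ⊆ e)
    (hk : Formula.IsKSAT k e) (hs : Formula.IsSimple e) : k < (Formula.vars T).card := by
  obtain ⟨c, hc, d, hd, hcd⟩ := one_lt_card.1 hT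
  have hne : Clause.vars c ≠ Clause.vars d := fun h => hcd (hs c (hTe hc) d (hTe hd) h)
  have hck := Clause.card_vars (hk c (hTe hc))
  have hdk := Clause.card_vars (hk d (hTe hd))
  have hss : Clause.vars c ⊂ Formula.vars T := by
    refine (vars_subset_of_mem hc).ssubset_of_ne fun h => hne ?_
    refine (eq_of_subset_of_card_le (h ▸ vars_subset_of_mem hd) ?_).symm
    rw [hck, hdk]
  exact hck ▸ card_lt_card hss

open scoped Classical in
/-- The indicator of the copies of `B` among all `k`-clauses on `n` variables. -/
noncomputable def copyWeight (k n : ℕ) (B e : Formula) : ℝ :=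
  if e ∈ Formula.copies B (allClauses k n) then 1 else 0

lemma wdeg_copyWeight {k n : ℕ} (B : Formula) {G : Formula} (hG : G ⊆ allClauses k n)
    (T : Formula) :
    wdeg G (copyWeight k n B) T = (#{e ∈ Formula.copies B G | T ⊆ e} : ℝ) := by
  classical
  unfold wdeg copyWeight
  rw [sum_boole]
  congr 2
  ext e
  simp only [mem_filter, mem_powerset, mem_copies]
  constructor
  · rintro ⟨⟨h1, h2⟩, _, h4⟩
    exact ⟨⟨h1, h4⟩, h2⟩
  · rintro ⟨⟨h1, h4⟩, h2⟩
    exact ⟨⟨h1, h2⟩, h1.trans hG, h4⟩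

lemma wdeg_copyWeight_le {k n m : ℕ} {B : Formula} (hs : Formula.IsSimple B)
    (hm : B.card ≤ m) (hm2 : 2 ≤ m) (hn : 1 ≤ n) {p : ℝ} (hp : 0 < p) (hp1 : p ≤ 1)
    (hpm : 1 / (n : ℝ) ≤ p ^ (m - 1)) {T : Formula} (hT : T.Nonempty) :
    wdeg (allClauses k n) (copyWeight k n B) T ≤
      (((Formula.vars B).card + 1 : ℝ) ^ (k + 1) * (n : ℝ) ^ (Formula.vars B).card / (n : ℝ) ^ k) *
        p ^ (T.card - 1) := by
  set v := (Formula.vars B).card with hv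
  have hn' : (0 : ℝ) < n := by exact_mod_cast hn
  rw [wdeg_copyWeight B Subset.rfl]
  rcases Finset.eq_empty_or_nonempty ({e ∈ Formula.copies B (allClauses k n) | T ⊆ e})
    with hempty | ⟨e, he⟩
  · rw [hempty, card_empty, Nat.cast_zero]
    positivity
  obtain ⟨he1, hTe⟩ := mem_filter.1 he
  obtain ⟨heA, heB⟩ := mem_copies.1 he1
  obtain ⟨hek, hen⟩ := subset_allClauses_iff.1 heA
  have hes := hs.of_isomorphic heB
  have hecard := hs.card_eq_of_isomorphic heB
  have hTn : Formula.vars T ⊆ range n := (vars_mono hTe).trans hen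
  -- Prescribing `l` variables saves a factor `n ^ l`: `l = k` serves one clause, `l = k + 1` two or
  -- more. The base `v + 1 ≥ 1` lets one constant cover every `l`, even if `v = 0`.
  have key : ∀ l, l ≤ k + 1 → l ≤ (Formula.vars T).card →
      (#{e ∈ Formula.copies B (allClauses k n) | T ⊆ e} : ℝ) ≤
        (v + 1 : ℝ) ^ (k + 1) * (n : ℝ) ^ v / (n : ℝ) ^ l := by
    intro l hlk hl
    obtain ⟨S, hST, rfl⟩ := exists_subset_card_eq hl
    rw [le_div_iff₀ (by positivity)]
    have h1 : (#{e ∈ Formula.copies B (allClauses k n) | T ⊆ e} : ℝ) * (n : ℝ) ^ S.card ≤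
        (v : ℝ) ^ S.card * (n : ℝ) ^ v := by
      exact_mod_cast card_copies_mul_le k n B T S hST hTn
    refine h1.trans (mul_le_mul_of_nonneg_right ?_ (by positivity))
    calc (v : ℝ) ^ S.card ≤ (v + 1 : ℝ) ^ S.card := by gcongr; linarith
      _ ≤ (v + 1 : ℝ) ^ (k + 1) :=
        pow_le_pow_right₀ (by linarith [Nat.cast_nonneg (α := ℝ) v]) hlk
  rcases Nat.lt_or_ge T.card 2 with h1 | h2
  · have hT1 : T.card = 1 := by have := hT.card_pos; omega
    obtain ⟨c, hc⟩ := hT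
    have := key k (Nat.le_succ k) (by
      rw [← Clause.card_vars (hek c (hTe hc))]
      exact card_le_card (vars_subset_of_mem hc))
    simpa [hT1] using this
  · refine (key (k + 1) le_rfl (lt_card_vars h2 hTe hek hes)).trans ?_
    -- `T` lies in a copy of `B`, hence has at most `m` clauses, so the single factor `1/n` suffices
    -- for every such `T`.
    have h3 : 1 / (n : ℝ) ≤ p ^ (T.card - 1) := by
      refine hpm.trans (pow_le_pow_of_le_one hp.le hp1 ?_)
      have := (card_le_card hTe).trans (hecard.le.trans hm)
      omega
    calc (v + 1 : ℝ) ^ (k + 1) * (n : ℝ) ^ v / (n : ℝ) ^ (k + 1)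
        = ((v + 1 : ℝ) ^ (k + 1) * (n : ℝ) ^ v / (n : ℝ) ^ k) * (1 / n) := by
          rw [pow_succ (n : ℝ) k]; field_simp
      _ ≤ _ := mul_le_mul_of_nonneg_left h3 (by positivity)

/-! ### Containers for formulae and their number -/

/-- The number of clauses needed to determine a container, up to a constant factor. -/
noncomputable def fingerprintSize (k m n : ℕ) : ℕ :=
  ⌈(n : ℝ) ^ (-(1 / ((m : ℝ) - 1))) * ((2 ^ k * n ^ k : ℕ) : ℝ)⌉₊

lemma exists_containers_of_formula (k : ℕ) {m : ℕ} (hm2 : 2 ≤ m) {B : Formula}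
    (hs : Formula.IsSimple B) (hm : B.card ≤ m) {δ : ℝ} (hδ : 0 < δ) :
    ∃ R : ℕ, ∀ n : ℕ, 1 ≤ n → ∃ 𝓒 : Finset Formula,
      𝓒.card ≤ (2 ^ k * n ^ k + 1) ^ (R * fingerprintSize k m n) ∧
      (∀ C ∈ 𝓒, C ⊆ allClauses k n ∧
        ((Formula.copies B C).card : ℝ) ≤ δ * (n : ℝ) ^ (Formula.vars B).card) ∧
      ∀ F ⊆ allClauses k n, Formula.copies B F = ∅ → ∃ C ∈ 𝓒, F ⊆ C := by
  set v := (Formula.vars B).card with hv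
  set K : ℝ := (v + 1 : ℝ) ^ (k + 1) with hK
  have hK0 : 0 < K := by positivity
  -- The density is chosen so that `a * N * D` equals `δ * n ^ v`.
  obtain ⟨R, hR⟩ := exists_containers (ι := Clause) B.card (δ / (2 ^ k * K)) (by positivity)
  refine ⟨R, fun n hn => ?_⟩
  have hn' : (0 : ℝ) < n := by exact_mod_cast hn
  have hn1 : (1 : ℝ) ≤ n := by exact_mod_cast hn
  have hm' : (0 : ℝ) < (m : ℝ) - 1 := by
    have : (2 : ℝ) ≤ m := by exact_mod_cast hm2
    linarith
  set p : ℝ := (n : ℝ) ^ (-(1 / ((m : ℝ) - 1))) with hp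
  have hp0 : 0 < p := Real.rpow_pos_of_pos hn' _
  have hp1 : p ≤ 1 := Real.rpow_le_one_of_one_le_of_nonpos hn1
    (neg_nonpos.2 (one_div_nonneg.2 hm'.le))
  have hpm : p ^ (m - 1) = 1 / (n : ℝ) := by
    rw [hp, ← Real.rpow_natCast, ← Real.rpow_mul hn'.le, Nat.cast_sub (by omega), Nat.cast_one,
      neg_mul, one_div_mul_cancel hm'.ne', Real.rpow_neg_one, one_div]
  obtain ⟨𝓒, h1, h2, h3⟩ := hR (allClauses k n) (2 ^ k * n ^ k) p (K * (n : ℝ) ^ v / (n : ℝ) ^ k)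
    (copyWeight k n B) (card_allClauses_le k n) (by positivity) hp0 (by positivity)
    (fun e => by unfold copyWeight; split_ifs <;> norm_num)
    (fun e he => by
      have : e ∈ Formula.copies B (allClauses k n) := by
        by_contra h
        exact he (if_neg h)
      exact hs.card_eq_of_isomorphic (mem_copies.1 this).2)
    (fun T hT => wdeg_copyWeight_le hs hm hm2 hn hp0 hp1 hpm.ge hT)
  refine ⟨𝓒, h1, fun C hC => ⟨(h2 C hC).1, ?_⟩, fun F hF hFB => h3 F hF ?_⟩
  · have h4 := (h2 C hC).2
    rw [wdeg_copyWeight B (h2 C hC).1] at h4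
    simp only [empty_subset, filter_true] at h4
    refine h4.trans (le_of_eq ?_)
    push_cast
    field_simp
  · intro e he
    refine if_neg fun h => ?_
    have : e ∈ Formula.copies B F := mem_copies.2 ⟨he, (mem_copies.1 h).2⟩
    rw [hFB] at this
    exact notMem_empty e this

/-- Intersecting containers for different `B` preserves covering and only lowers copy counts; the
family sizes multiply, so the exponents `R` add. -/
lemma exists_containers_of_formulas (k : ℕ) {m : ℕ} (hm2 : 2 ≤ m) {δ : ℝ} (hδ : 0 < δ)
    (𝓑 : Finset Formula) (hs : ∀ B ∈ 𝓑, Formula.IsSimple B) (hm : ∀ B ∈ 𝓑, B.card ≤ m) :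
    ∃ R : ℕ, ∀ n : ℕ, 1 ≤ n → ∃ 𝓖 : Finset Formula,
      𝓖.card ≤ (2 ^ k * n ^ k + 1) ^ (R * fingerprintSize k m n) ∧
      (∀ G ∈ 𝓖, G ⊆ allClauses k n ∧ ∀ B ∈ 𝓑,
        ((Formula.copies B G).card : ℝ) ≤ δ * (n : ℝ) ^ (Formula.vars B).card) ∧
      ∀ F ⊆ allClauses k n, Formula.IsFree 𝓑 F → ∃ G ∈ 𝓖, F ⊆ G := by
  induction 𝓑 using Finset.induction_on with
  | empty => exact ⟨0, fun n _ => ⟨{allClauses k n}, by simp, by simp, fun F hF _ => by simpa⟩⟩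
  | insert B 𝓑 _ ih =>
    obtain ⟨R₁, h1⟩ := ih (fun B' h => hs B' (mem_insert_of_mem h))
      (fun B' h => hm B' (mem_insert_of_mem h))
    obtain ⟨R₂, h2⟩ := exists_containers_of_formula k hm2 (hs B (mem_insert_self _ _))
      (hm B (mem_insert_self _ _)) hδ
    refine ⟨R₁ + R₂, fun n hn => ?_⟩
    obtain ⟨𝓖, hG1, hG2, hG3⟩ := h1 n hn
    obtain ⟨𝓒, hC1, hC2, hC3⟩ := h2 n hn
    refine ⟨image₂ (· ∩ ·) 𝓖 𝓒, ?_, ?_, ?_⟩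
    · refine (card_image₂_le _ _ _).trans ((Nat.mul_le_mul hG1 hC1).trans (le_of_eq ?_))
      rw [← pow_add, add_mul]
    · intro X hX
      obtain ⟨G, hG, C, hC, rfl⟩ := mem_image₂.1 hX
      refine ⟨inter_subset_left.trans (hG2 G hG).1, fun B' hB' => ?_⟩
      rcases mem_insert.1 hB' with rfl | hB'
      · refine le_trans ?_ (hC2 C hC).2
        exact_mod_cast card_le_card (copies_mono B' inter_subset_right)
      · refine le_trans ?_ ((hG2 G hG).2 B' hB')
        exact_mod_cast card_le_card (copies_mono B' inter_subset_left)
    · intro F hF hfree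
      obtain ⟨G, hG, hFG⟩ := hG3 F hF fun B' h => hfree B' (mem_insert_of_mem h)
      obtain ⟨C, hC, hFC⟩ := hC3 F hF (hfree B (mem_insert_self _ _))
      exact ⟨G ∩ C, mem_image₂.2 ⟨G, hG, C, hC, rfl⟩, subset_inter hFG hFC⟩

/-- On a single variable, one container suffices. -/
lemma exists_container_of_one_variable {k : ℕ} (hk : 1 ≤ k) (𝓑 : Finset Formula)
    (hs : ∀ B ∈ 𝓑, Formula.IsSimple B) :
    ∃ 𝓖 : Finset Formula, 𝓖.card ≤ 1 ∧
      (∀ G ∈ 𝓖, G ⊆ allClauses k 1 ∧ Formula.IsFree 𝓑 G) ∧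
      ∀ F ⊆ allClauses k 1, Formula.IsFree 𝓑 F → ∃ G ∈ 𝓖, F ⊆ G := by
  classical
  by_cases hfree : ∃ F ⊆ allClauses k 1, Formula.IsFree 𝓑 F
  swap
  · exact ⟨∅, by simp, by simp, fun F hF h => absurd ⟨F, hF, h⟩ hfree⟩
  obtain ⟨F₀, _, hF₀⟩ := hfree
  -- All clauses share the variable set `{0}`, so a simple copy has at most one clause, and freeness
  -- can be tested clause by clause.
  refine ⟨{{c ∈ allClauses k 1 | Formula.IsFree 𝓑 {c}}}, by simp, ?_, ?_⟩
  · intro G hG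
    obtain rfl := mem_singleton.1 hG
    refine ⟨filter_subset _ _, fun B hB => eq_empty_of_forall_notMem fun e he => ?_⟩
    obtain ⟨heU, heB⟩ := mem_copies.1 he
    have hvars : ∀ c ∈ e, Clause.vars c = {0} := fun c hc => by
      obtain ⟨h1, h2⟩ := mem_allClauses.1 (mem_filter.1 (heU hc)).1
      refine (subset_singleton_iff.1 h1).resolve_left fun h => ?_
      have := Clause.card_vars h2
      rw [h, card_empty] at this
      omega
    -- An empty member of `𝓑` would have a copy in every formula, contradicting the existence of
    -- `F₀`.
    rcases e.eq_empty_or_nonempty with rfl | ⟨c, hc⟩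
    · have : ∅ ∈ Formula.copies B F₀ := mem_copies.2 ⟨empty_subset _, heB⟩
      rw [hF₀ B hB] at this
      exact notMem_empty _ this
    · have hec : e = {c} := eq_singleton_iff_unique_mem.2 ⟨hc, fun d hd =>
        (hs B hB).of_isomorphic heB d hd c hc ((hvars d hd).trans (hvars c hc).symm)⟩
      have : e ∈ Formula.copies B {c} := mem_copies.2 ⟨hec.le, heB⟩
      rw [(mem_filter.1 (heU hc)).2 B hB] at this
      exact notMem_empty _ this
  · intro F hF hfree
    refine ⟨_, mem_singleton_self _, fun c hc => mem_filter.2 ⟨hF hc, fun B hB => ?_⟩⟩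
    exact subset_empty.1 ((copies_mono B (singleton_subset_iff.2 hc)).trans (hfree B hB).le)

/-- Since `n ≥ 2`, the base is at most `n ^ (2 * k + 1)`. The power of `n` in the exponent is at
least `1`, so it absorbs the rounding in `fingerprintSize`. The final `+ 1` keeps the constant
positive when `R = 0`. -/
lemma container_count_le {k m n : ℕ} (hk : 1 ≤ k) (hm : 2 ≤ m) (hn : 2 ≤ n) (R : ℕ) :
    (((2 ^ k * n ^ k + 1) ^ (R * fingerprintSize k m n) : ℕ) : ℝ) ≤
      (n : ℝ) ^ ((((2 * k + 1) * R * (2 ^ k + 1) + 1 : ℕ) : ℝ) *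
        (n : ℝ) ^ ((k : ℝ) - 1 / ((m : ℝ) - 1))) := by
  have hn1 : (1 : ℝ) ≤ n := by exact_mod_cast (by omega : 1 ≤ n)
  have hn0 : (0 : ℝ) < n := by linarith
  have hm' : (1 : ℝ) ≤ (m : ℝ) - 1 := by
    have : (2 : ℝ) ≤ m := by exact_mod_cast hm
    linarith
  have hk' : (1 : ℝ) ≤ k := by exact_mod_cast hk
  set y : ℝ := (n : ℝ) ^ ((k : ℝ) - 1 / ((m : ℝ) - 1)) with hy
  have hy1 : 1 ≤ y := by
    refine Real.one_le_rpow hn1 ?_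
    have : 1 / ((m : ℝ) - 1) ≤ 1 := (div_le_one (by linarith)).2 hm'
    linarith
  have hq : (fingerprintSize k m n : ℝ) ≤ (2 ^ k + 1) * y := by
    have h1 : (n : ℝ) ^ (-(1 / ((m : ℝ) - 1))) * ((2 ^ k * n ^ k : ℕ) : ℝ) = 2 ^ k * y := by
      rw [hy, sub_eq_add_neg (k : ℝ), Real.rpow_add hn0, Real.rpow_natCast]
      push_cast
      ring
    have h2 := (Nat.ceil_lt_add_one (a := (n : ℝ) ^ (-(1 / ((m : ℝ) - 1))) *
      ((2 ^ k * n ^ k : ℕ) : ℝ)) (by positivity)).le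
    rw [h1] at h2
    rw [fingerprintSize, h1]
    linarith
  have hbase : 2 ^ k * n ^ k + 1 ≤ n ^ (2 * k + 1) := by
    have h1 : 2 ^ k * n ^ k ≤ n ^ (2 * k) := by
      rw [two_mul, pow_add]
      exact Nat.mul_le_mul_right _ (Nat.pow_le_pow_left hn k)
    have h2 : 1 ≤ n ^ (2 * k) := Nat.one_le_pow _ _ (by omega)
    calc 2 ^ k * n ^ k + 1 ≤ n ^ (2 * k) * 2 := by omega
      _ ≤ n ^ (2 * k) * n := Nat.mul_le_mul_left _ hn
      _ = n ^ (2 * k + 1) := (pow_succ _ _).symm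
  have hnat : (2 ^ k * n ^ k + 1) ^ (R * fingerprintSize k m n) ≤
      n ^ ((2 * k + 1) * (R * fingerprintSize k m n)) := by
    rw [pow_mul n]
    exact Nat.pow_le_pow_left hbase _
  refine (Nat.cast_le.2 hnat).trans ?_
  rw [Nat.cast_pow, ← Real.rpow_natCast]
  refine Real.rpow_le_rpow_of_exponent_le hn1 ?_
  push_cast
  calc (2 * k + 1 : ℝ) * (R * fingerprintSize k m n)
      ≤ (2 * k + 1 : ℝ) * (R * ((2 ^ k + 1) * y)) := by gcongr
    _ ≤ ((2 * k + 1) * R * (2 ^ k + 1) + 1) * y := by linarith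

end KSat

theorem theorem3p4 (k : ℕ) (hk : 1 ≤ k) (𝓑 : Finset KSat.Formula)
    (hKSAT : ∀ B ∈ 𝓑, KSat.Formula.IsKSAT k B)
    (hSimple : ∀ B ∈ 𝓑, KSat.Formula.IsSimple B)
    (hm : 2 ≤ KSat.maxSize 𝓑) (δ : ℝ) (hδ : 0 < δ) :
    ∃ C : ℝ, 0 < C ∧ ∀ n : ℕ, 1 ≤ n →
      ∃ 𝓖 : Finset KSat.Formula,
        (∀ G ∈ 𝓖, KSat.Formula.IsKSATOn k n G) ∧
        (∀ F : KSat.Formula, KSat.Formula.IsKSATOn k n F → KSat.Formula.IsFree 𝓑 F →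
          ∃ G ∈ 𝓖, F ⊆ G) ∧
        (∀ G ∈ 𝓖, ∀ B ∈ 𝓑,
          ((KSat.Formula.copies B G).card : ℝ) ≤ δ * (n : ℝ) ^ (KSat.Formula.vars B).card) ∧
        (𝓖.card : ℝ) ≤
          (n : ℝ) ^ (C * (n : ℝ) ^ ((k : ℝ) - 1 / ((KSat.maxSize 𝓑 : ℝ) - 1))) := by
  obtain ⟨R, hR⟩ := KSat.exists_containers_of_formulas k hm hδ 𝓑 hSimple
    fun B hB => Finset.le_sup (f := Finset.card) hB
  refine ⟨(((2 * k + 1) * R * (2 ^ k + 1) + 1 : ℕ) : ℝ), by positivity, fun n hn => ?_⟩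
  -- For `n = 1` the required bound equals `1`, which the general count does not give.
  rcases hn.eq_or_lt with rfl | hn2
  · obtain ⟨𝓖, h1, h2, h3⟩ := KSat.exists_container_of_one_variable hk 𝓑 hSimple
    refine ⟨𝓖, fun G hG => KSat.subset_allClauses_iff.1 (h2 G hG).1,
      fun F hF => h3 F (KSat.subset_allClauses_iff.2 hF), fun G hG B hB => ?_, ?_⟩
    · rw [(h2 G hG).2 B hB, Finset.card_empty, Nat.cast_zero]
      positivity
    · simpa using h1
  · obtain ⟨𝓖, h1, h2, h3⟩ := hR n hn
    exact ⟨𝓖, fun G hG => KSat.subset_allClauses_iff.1 (h2 G hG).1,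
      fun F hF => h3 F (KSat.subset_allClauses_iff.2 hF), fun G hG => (h2 G hG).2,
      (Nat.cast_le.2 h1).trans (KSat.container_count_le hk hm hn2 R)⟩
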